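/- Let $G$ be a countable group and let $\mu$ be a probability measure on $G$ whose support generates $G$ as a semigroup (that is, $(G,\mu)$ is a measured group). A function $f : G \to \mathbb{C}$ is called left $\mu$-harmonic if $\int_G |f(sg)|\,d\mu(s)<\infty$ and $f(g) = \int_G f(sg)\,d\mu(s)$ for all $g \in G$, and right $\mu$-harmonic if $\int_G |f(gs)|\,d\mu(s)<\infty$ and $f(g) = \int_G f(gs)\,d\mu(s)$ for all $g \in G$. Then every bounded function $f : G \to \mathbb{C}$ that is both left and right $\mu$-harmonic is constant. In particular, if $G$ is abelian, then every bounded function $f : G\to\mathbb{C}$ that is left $\mu$-harmonic or right $\mu$-harmonic is constant. -/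

import Mathlib

open MeasureTheory

/-- `μ` makes the countable group `G` a *measured group*: `μ` is a probability measure on `G`
(all subsets being measurable) whose support, the set of its atoms, generates `G` as a
semigroup. -/
structure IsMeasuredGroup {G : Type*} [Group G] [MeasurableSpace G] (μ : Measure G) : Prop where
  isProbabilityMeasure : IsProbabilityMeasure μ
  closure_support : Subsemigroup.closure {g : G | μ {g} ≠ 0} = ⊤

/-- `f` is left `μ`-harmonic: `f g = ∫ f (s g) dμ(s)` for all `g`. -/
structure IsLeftHarmonic {G : Type*} [Group G] [MeasurableSpace G] (μ : Measure G)
    (f : G → ℂ) : Prop where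
  integrable : ∀ g : G, Integrable (fun s => f (s * g)) μ
  integral_eq : ∀ g : G, ∫ s, f (s * g) ∂μ = f g

/-- `f` is right `μ`-harmonic: `f g = ∫ f (g s) dμ(s)` for all `g`. -/
structure IsRightHarmonic {G : Type*} [Group G] [MeasurableSpace G] (μ : Measure G)
    (f : G → ℂ) : Prop where
  integrable : ∀ g : G, Integrable (fun s => f (g * s)) μ
  integral_eq : ∀ g : G, ∫ s, f (g * s) ∂μ = f g

/-- `f` is a bounded function. -/
def IsBoundedFun {G : Type*} (f : G → ℂ) : Prop := ∃ C : ℝ, ∀ g : G, ‖f g‖ ≤ C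

/-! Let the real and imaginary parts play the role of `u`. If `u` is bounded and biharmonic for `ν`
and `σ`, right harmonicity for `σ` makes the increments `u (x * s) - u x` orthogonal to `u x`, so
their mean square is the growth of the second moment from `ν` to `ν.mconv σ`. Left harmonicity for
`ν` and Jensen in `x` bound it below by `∫ (u s - u 1) ^ 2 ∂σ`, which does not depend on `ν`. A
bounded second moment cannot grow by a fixed positive amount at every step, so `u = u 1` at the
atoms of `σ`. Taking for `σ` the convolution powers of `μ` reaches all of `G`. -/

/-- A real function that is both left and right harmonic, without the integrability conditions,
which are automatic for bounded functions on a discrete group. -/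
structure IsBiharmonic {G : Type*} [Group G] [MeasurableSpace G] (σ : Measure G)
    (u : G → ℝ) : Prop where
  left : ∀ g : G, ∫ s, u (s * g) ∂σ = u g
  right : ∀ g : G, ∫ s, u (g * s) ∂σ = u g

theorem integrable_of_discrete_of_bound {α : Type*} [MeasurableSpace α]
    [DiscreteMeasurableSpace α] (ν : Measure α) [IsFiniteMeasure ν] {v : α → ℝ} {C : ℝ}
    (hv : ∀ x, |v x| ≤ C) : Integrable v ν :=
  Integrable.of_bound Measurable.of_discrete.aestronglyMeasurable C (Filter.Eventually.of_forall hv)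

theorem abs_sq_le_of_abs_le {a C : ℝ} (h : |a| ≤ C) : |a ^ 2| ≤ C ^ 2 := by
  rw [abs_pow]
  exact pow_le_pow_left₀ (abs_nonneg a) h 2

theorem abs_sub_le_two_mul {a b C : ℝ} (ha : |a| ≤ C) (hb : |b| ≤ C) : |a - b| ≤ 2 * C := by
  linarith [abs_sub a b]

/-- The second moment about an arbitrary point `c`. -/
theorem integral_sub_const_sq {α : Type*} [MeasurableSpace α] (ν : Measure α)
    [IsProbabilityMeasure ν] {v : α → ℝ} (hv : Integrable v ν)
    (hv2 : Integrable (fun x => v x ^ 2) ν) (c : ℝ) :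
    ∫ x, (v x - c) ^ 2 ∂ν = ∫ x, v x ^ 2 ∂ν - 2 * c * ∫ x, v x ∂ν + c ^ 2 := by
  have h : ∀ x, (v x - c) ^ 2 = v x ^ 2 - 2 * c * v x + c ^ 2 := fun x => by ring
  simp_rw [h]
  have hs : Integrable (fun x => v x ^ 2 - 2 * c * v x) ν := hv2.sub (hv.const_mul _)
  rw [integral_add hs (integrable_const _), integral_sub hv2 (hv.const_mul _), integral_const_mul]
  simp

theorem sq_integral_le_integral_sq {α : Type*} [MeasurableSpace α] (ν : Measure α)
    [IsProbabilityMeasure ν] {v : α → ℝ} (hv : Integrable v ν)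
    (hv2 : Integrable (fun x => v x ^ 2) ν) :
    (∫ x, v x ∂ν) ^ 2 ≤ ∫ x, v x ^ 2 ∂ν := by
  have h := integral_sub_const_sq ν hv hv2 (∫ x, v x ∂ν)
  have h0 : 0 ≤ ∫ x, (v x - ∫ y, v y ∂ν) ^ 2 ∂ν := integral_nonneg fun x => sq_nonneg _
  nlinarith

section Discrete

variable {G : Type*} [Group G] [Countable G] [MeasurableSpace G] [DiscreteMeasurableSpace G]

theorem integral_mconv_of_bound (ν σ : Measure G) [IsProbabilityMeasure ν]
    [IsProbabilityMeasure σ] {v : G → ℝ} {C : ℝ} (hv : ∀ x, |v x| ≤ C) :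
    ∫ x, v x ∂(ν.mconv σ) = ∫ x, ∫ y, v (x * y) ∂σ ∂ν :=
  integral_mconv (integrable_of_discrete_of_bound _ hv)

theorem IsBiharmonic.mconv {ν σ : Measure G} [IsProbabilityMeasure ν] [IsProbabilityMeasure σ]
    {u : G → ℝ} {C : ℝ} (hu : ∀ g, |u g| ≤ C) (hν : IsBiharmonic ν u) (hσ : IsBiharmonic σ u) :
    IsBiharmonic (ν.mconv σ) u where
  left g := by
    -- Left harmonicity absorbs the outermost factor first, so the `ν` variable must be integrated
    -- first; on the right no swap is needed.
    rw [integral_mconv_of_bound ν σ (v := fun s => u (s * g)) (fun x => hu _),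
      integral_integral_swap (integrable_of_discrete_of_bound _ (fun x => hu _))]
    simp_rw [mul_assoc, hν.left, hσ.left]
  right g := by
    rw [integral_mconv_of_bound ν σ (v := fun s => u (g * s)) (fun x => hu _)]
    simp_rw [← mul_assoc, hσ.right, hν.right]

/-- The mean square increment of `u` at `1` is at most the growth of the second moment of `u`
along the random walk. -/
theorem IsBiharmonic.integral_sub_sq_le {ν σ : Measure G} [IsProbabilityMeasure ν]
    [IsProbabilityMeasure σ] {u : G → ℝ} {C : ℝ} (hu : ∀ g, |u g| ≤ C)
    (hν : IsBiharmonic ν u) (hσ : IsBiharmonic σ u) :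
    ∫ s, (u s - u 1) ^ 2 ∂σ ≤ ∫ x, u x ^ 2 ∂(ν.mconv σ) - ∫ x, u x ^ 2 ∂ν := by
  have hu2 : ∀ g, |u g ^ 2| ≤ C ^ 2 := fun g => abs_sq_le_of_abs_le (hu g)
  have hd : ∀ x s, |u (x * s) - u x| ≤ 2 * C := fun x s => abs_sub_le_two_mul (hu _) (hu _)
  have hd2 : ∀ x s, |(u (x * s) - u x) ^ 2| ≤ (2 * C) ^ 2 := fun x s =>
    abs_sq_le_of_abs_le (hd x s)
  have hswap : ∫ x, ∫ s, (u (x * s) - u x) ^ 2 ∂σ ∂ν = ∫ s, ∫ x, (u (x * s) - u x) ^ 2 ∂ν ∂σ :=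
    integral_integral_swap (integrable_of_discrete_of_bound _ (fun p => hd2 p.1 p.2))
  have hint : Integrable (fun s => ∫ x, (u (x * s) - u x) ^ 2 ∂ν) σ :=
    Integrable.integral_prod_right (f := fun p : G × G => (u (p.1 * p.2) - u p.1) ^ 2)
      (integrable_of_discrete_of_bound (ν.prod σ) (fun p => hd2 p.1 p.2))
  have hint' : Integrable (fun x => ∫ s, u (x * s) ^ 2 ∂σ) ν :=
    Integrable.integral_prod_left (f := fun p : G × G => u (p.1 * p.2) ^ 2)
      (integrable_of_discrete_of_bound (ν.prod σ) (fun p => hu2 _))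
  -- For fixed `x`, `u x` is the `σ`-mean of `u (x * s)`, so the inner integral is a variance.
  have hright : ∫ x, ∫ s, (u (x * s) - u x) ^ 2 ∂σ ∂ν
      = ∫ x, u x ^ 2 ∂(ν.mconv σ) - ∫ x, u x ^ 2 ∂ν := by
    rw [integral_mconv_of_bound ν σ hu2,
      ← integral_sub hint' (integrable_of_discrete_of_bound ν hu2)]
    refine integral_congr_ae (Filter.Eventually.of_forall fun x => ?_)
    simp only
    rw [integral_sub_const_sq σ (integrable_of_discrete_of_bound σ fun s => hu (x * s))
      (integrable_of_discrete_of_bound σ fun s => hu2 (x * s)), hσ.right]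
    ring
  rw [← hright, hswap]
  refine integral_mono (integrable_of_discrete_of_bound σ (C := (2 * C) ^ 2) fun s =>
    abs_sq_le_of_abs_le (abs_sub_le_two_mul (hu _) (hu _))) hint fun s => ?_
  -- Averaging over the left factor `x` removes it from both terms.
  have h1 : ∫ x, (u (x * s) - u x) ∂ν = u s - u 1 := by
    have h := hν.left 1
    simp only [mul_one] at h
    rw [integral_sub (integrable_of_discrete_of_bound ν fun x => hu _)
      (integrable_of_discrete_of_bound ν hu), hν.left, h]
  simp only
  rw [← h1]
  exact sq_integral_le_integral_sq ν (integrable_of_discrete_of_bound ν fun x => hd x s)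
    (integrable_of_discrete_of_bound ν fun x => hd2 x s)

/-- The witness is the `(n + 1)`-fold convolution power of `σ`; each further factor adds at least
the same increment. -/
theorem IsBiharmonic.exists_nat_mul_le {σ : Measure G} [IsProbabilityMeasure σ] {u : G → ℝ}
    {C : ℝ} (hu : ∀ g, |u g| ≤ C) (hσ : IsBiharmonic σ u) (n : ℕ) :
    ∃ ν : Measure G, IsProbabilityMeasure ν ∧ IsBiharmonic ν u ∧
      n * ∫ s, (u s - u 1) ^ 2 ∂σ ≤ ∫ x, u x ^ 2 ∂ν := by
  induction n with
  | zero =>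
    refine ⟨σ, inferInstance, hσ, ?_⟩
    rw [Nat.cast_zero, zero_mul]
    exact integral_nonneg fun x => sq_nonneg _
  | succ n ih =>
    obtain ⟨ν, hp, hν, hle⟩ := ih
    refine ⟨ν.mconv σ, inferInstance, hν.mconv hu hσ, ?_⟩
    have := hν.integral_sub_sq_le hu hσ
    push_cast
    linarith

theorem IsBiharmonic.integral_sub_sq_eq_zero {σ : Measure G} [IsProbabilityMeasure σ]
    {u : G → ℝ} {C : ℝ} (hu : ∀ g, |u g| ≤ C) (hσ : IsBiharmonic σ u) :
    ∫ s, (u s - u 1) ^ 2 ∂σ = 0 := by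
  refine le_antisymm (not_lt.1 fun hpos => ?_) (integral_nonneg fun s => sq_nonneg _)
  obtain ⟨n, hn⟩ := exists_nat_gt (C ^ 2 / ∫ s, (u s - u 1) ^ 2 ∂σ)
  rw [div_lt_iff₀ hpos] at hn
  obtain ⟨ν, hp, -, hle⟩ := hσ.exists_nat_mul_le hu n
  have hle' : ∫ x, u x ^ 2 ∂ν ≤ ∫ _, C ^ 2 ∂ν :=
    integral_mono (integrable_of_discrete_of_bound ν fun g => abs_sq_le_of_abs_le (hu g))
      (integrable_const _) fun x => (le_abs_self _).trans (abs_sq_le_of_abs_le (hu x))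
  rw [integral_const, probReal_univ, one_smul] at hle'
  linarith

theorem IsBiharmonic.eq_of_measure_ne_zero {σ : Measure G} [IsProbabilityMeasure σ]
    {u : G → ℝ} {C : ℝ} (hu : ∀ g, |u g| ≤ C) (hσ : IsBiharmonic σ u) {g : G}
    (hg : σ {g} ≠ 0) : u g = u 1 := by
  have h := (integral_eq_zero_iff_of_nonneg (fun s => sq_nonneg (u s - u 1))
    (integrable_of_discrete_of_bound σ (C := (2 * C) ^ 2) fun s =>
      abs_sq_le_of_abs_le (abs_sub_le_two_mul (hu _) (hu _)))).1 (hσ.integral_sub_sq_eq_zero hu)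
  by_contra hne
  refine hg (measure_mono_null (fun s hs => ?_) (ae_iff.1 h))
  rw [Set.mem_singleton_iff.1 hs]
  exact pow_ne_zero 2 (sub_ne_zero.2 hne)

theorem mconv_singleton_mul_ne_zero {ν σ : Measure G} [IsProbabilityMeasure ν]
    [IsProbabilityMeasure σ] {a b : G} (ha : ν {a} ≠ 0) (hb : σ {b} ≠ 0) :
    (ν.mconv σ) {a * b} ≠ 0 := by
  rw [Measure.mconv, Measure.map_apply measurable_mul (MeasurableSet.singleton _)]
  intro h
  have h' : (ν.prod σ) ({a} ×ˢ {b}) = 0 := by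
    refine measure_mono_null (fun p hp => ?_) h
    obtain ⟨h1, h2⟩ := hp
    rw [Set.mem_singleton_iff] at h1 h2
    simp [h1, h2]
  rw [Measure.prod_prod] at h'
  exact mul_ne_zero ha hb h'

/-- Bounded biharmonic functions on a measured group are constant. -/
theorem IsBiharmonic.eq_apply_one {μ : Measure G} (hμ : IsMeasuredGroup μ) {u : G → ℝ} {C : ℝ}
    (hu : ∀ g, |u g| ≤ C) (h : IsBiharmonic μ u) (g : G) : u g = u 1 := by
  have hg : g ∈ Subsemigroup.closure {g : G | μ {g} ≠ 0} := by
    rw [hμ.closure_support]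
    trivial
  -- A product of `k` atoms of `μ` is an atom of a `k`-fold convolution power of `μ`, for which `u`
  -- is still biharmonic.
  have key : ∃ σ : Measure G, IsProbabilityMeasure σ ∧ IsBiharmonic σ u ∧ σ {g} ≠ 0 := by
    induction hg using Subsemigroup.closure_induction with
    | mem x hx => exact ⟨μ, hμ.isProbabilityMeasure, h, hx⟩
    | mul x y _ _ hx hy =>
      obtain ⟨ν, _, hν, hνx⟩ := hx
      obtain ⟨σ, _, hσ, hσy⟩ := hy
      exact ⟨ν.mconv σ, inferInstance, hν.mconv hu hσ, mconv_singleton_mul_ne_zero hνx hσy⟩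
  obtain ⟨σ, _, hσ, hσg⟩ := key
  exact hσ.eq_of_measure_ne_zero hu hσg

theorem exists_eq_const_of_harmonic {μ : Measure G} (hμ : IsMeasuredGroup μ) {f : G → ℂ}
    (hf : IsBoundedFun f) (hl : IsLeftHarmonic μ f) (hr : IsRightHarmonic μ f) :
    ∃ c : ℂ, ∀ g : G, f g = c := by
  obtain ⟨C, hC⟩ := hf
  have hre : IsBiharmonic μ fun g => (f g).re :=
    ⟨fun g => (integral_re (hl.integrable g)).trans (congrArg Complex.re (hl.integral_eq g)),
      fun g => (integral_re (hr.integrable g)).trans (congrArg Complex.re (hr.integral_eq g))⟩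
  have him : IsBiharmonic μ fun g => (f g).im :=
    ⟨fun g => (integral_im (hl.integrable g)).trans (congrArg Complex.im (hl.integral_eq g)),
      fun g => (integral_im (hr.integrable g)).trans (congrArg Complex.im (hr.integral_eq g))⟩
  exact ⟨f 1, fun g => Complex.ext
    (hre.eq_apply_one hμ (fun g => (Complex.abs_re_le_norm _).trans (hC g)) g)
    (him.eq_apply_one hμ (fun g => (Complex.abs_im_le_norm _).trans (hC g)) g)⟩

end Discrete

theorem isLeftHarmonic_iff_isRightHarmonic {G : Type*} [Group G] [MeasurableSpace G]
    (hG : ∀ a b : G, a * b = b * a) (μ : Measure G) (f : G → ℂ) :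
    IsLeftHarmonic μ f ↔ IsRightHarmonic μ f := by
  constructor <;> rintro ⟨hi, he⟩ <;> refine ⟨fun g => ?_, fun g => ?_⟩
  · simpa only [hG g] using hi g
  · simpa only [hG g] using he g
  · simpa only [hG g] using hi g
  · simpa only [hG g] using he g

theorem mainTheorem5 {G : Type*} [Group G] [Countable G] [MeasurableSpace G]
    [DiscreteMeasurableSpace G] (μ : Measure G) (hμ : IsMeasuredGroup μ) :
    (∀ f : G → ℂ, IsBoundedFun f → IsLeftHarmonic μ f → IsRightHarmonic μ f →
      ∃ c : ℂ, ∀ g : G, f g = c) ∧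
    ((∀ a b : G, a * b = b * a) →
      ∀ f : G → ℂ, IsBoundedFun f → (IsLeftHarmonic μ f ∨ IsRightHarmonic μ f) →
        ∃ c : ℂ, ∀ g : G, f g = c) := by
  refine ⟨fun f hf hl hr => exists_eq_const_of_harmonic hμ hf hl hr, fun hG f hf h => ?_⟩
  rcases h with hl | hr
  · exact exists_eq_const_of_harmonic hμ hf hl ((isLeftHarmonic_iff_isRightHarmonic hG μ f).1 hl)
  · exact exists_eq_const_of_harmonic hμ hf ((isLeftHarmonic_iff_isRightHarmonic hG μ f).2 hr) hr
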